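/- Let $\mathcal U$ be a complex Banach space. An evolution $\Psi=(\psi,s)$ in $\mathcal U$ consists of a linear (not necessarily bounded) operator $\psi:\mathcal U\to\mathcal U$ and a vector $s\in\mathcal U$; its states are $\psi^t s$, $t=0,1,2,\ldots$ Let $\mathcal U_\Psi=\mathrm{lin}\{\psi^t s\mid t\ge 0\}$ be its evolution space and $\overline{\mathcal U}_\Psi$ the norm closure of $\mathcal U_\Psi$. - $\Psi$ is *finite-dimensional* if $\dim\mathcal U_\Psi<\infty$, and *finitary* if there is a finite-dimensional evolution $(\varphi,v)$ in $\mathcal U$ with $\lim_{t\to\infty}\|\psi^t s-\varphi^t v\|=0$. - $\Psi$ is *stable* if $\|\Psi\|=\inf\{c\in\mathbb R\mid \|\psi^t s\|\le c\|s\|\ \text{for all } t\ge 0\}<\infty$ (where $\inf\emptyset=\infty$). - $\Psi$ is *mean ergodic* if the averages $\frac1t\sum_{m=1}^t\psi^m s$ converge in norm to some element of $\overline{\mathcal U}_\Psi$ as $t\to\infty$. - A bounded operator $T$ on a complex Banach space is a *Riesz operator* if each $\lambda\in\sigma(T)\setminus\{0\}$ is an eigenvalue of finite algebraic multiplicity (i.e.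 $\lambda$ is isolated in $\sigma(T)$ and its spectral projection $\frac1{2\pi i}\oint_{|z-\lambda|=r}(z-T)^{-1}\,dz$, $r>0$ small, has finite rank), and $0$ is the only possible accumulation point of $\sigma(T)$. - $\Psi$ is a *Riesz evolution* if the restriction of $\psi$ to $\mathcal U_\Psi$ extends to a Riesz operator $\overline\psi:\overline{\mathcal U}_\Psi\to\overline{\mathcal U}_\Psi$ (this bounded extension is then unique). **Theorem.** Let $\Psi=(\psi,s)$ be a Riesz evolution in $\mathcal U$. Then $\Psi$ is finitary. Moreover, $\Psi$ is mean ergodic if and only if $\Psi$ is stable. If $\Psi$ is stable, then: - if $1$ is not an eigenvalue of $\overline\psi$, then $\lim_{t\to\infty}\frac1t\sum_{m=1}^t\psi^m s=0$, and more generally $\lim_{t\to\infty}\frac1t\sum_{m=1}^t\overline\psi^{\,m} v=0$ for every $v\in\overline{\mathcal U}_\Psi$; - if $1$ is an eigenvalue of $\overline\psi$, then there is a bounded linear projection $P_1$ of $\overline{\mathcal U}_\Psi$ onto the eigenspace $E_1=\{x\in\overline{\mathcal U}_\Psi\mid \overline\psi x=x\}$ such that $\lim_{t\to\infty}\frac1t\sum_{m=1}^t\psi^m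 s=P_1s$, and more generally $\lim_{t\to\infty}\frac1t\sum_{m=1}^t\overline\psi^{\,m} v=P_1v$ for every $v\in\overline{\mathcal U}_\Psi$. -/

import Mathlib

open Filter Topology

noncomputable section

/-- An evolution `(ψ, s) = (ψᵗ s)_{t ≥ 0}` in the complex normed space `U`: a linear (not
necessarily bounded) operator `ψ` on `U` together with an initial state `s`. -/
structure Evolution (U : Type*) [NormedAddCommGroup U] [NormedSpace ℂ U] where
  op : U →ₗ[ℂ] U
  init : U

namespace Evolution

variable {U : Type*} [NormedAddCommGroup U] [NormedSpace ℂ U]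

/-- The state `s⁽ᵗ⁾ = ψᵗ s`. -/
def state (Ψ : Evolution U) (t : ℕ) : U := (Ψ.op ^ t) Ψ.init

/-- The evolution space, the linear hull of all the states. -/
def space (Ψ : Evolution U) : Submodule ℂ U := Submodule.span ℂ (Set.range Ψ.state)

/-- The closed evolution space, the norm closure of the evolution space. -/
abbrev closedSpace (Ψ : Evolution U) : Submodule ℂ U := Ψ.space.topologicalClosure

theorem state_mem_space (Ψ : Evolution U) (t : ℕ) : Ψ.state t ∈ Ψ.space :=
  Submodule.subset_span ⟨t, rfl⟩

theorem init_mem_closedSpace (Ψ : Evolution U) : Ψ.init ∈ Ψ.closedSpace :=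
  Ψ.space.le_topologicalClosure (Ψ.state_mem_space 0)

/-- The initial state as a vector of the closed evolution space. -/
def closedInit (Ψ : Evolution U) : Ψ.closedSpace := ⟨Ψ.init, Ψ.init_mem_closedSpace⟩

/-- The evolution is finite-dimensional. -/
def IsFiniteDimensional (Ψ : Evolution U) : Prop := FiniteDimensional ℂ Ψ.space

/-- The norm of the evolution, `inf {c ∈ ℝ | ‖ψᵗ s‖ ≤ c ‖s‖ for all t ≥ 0}`, as an extended real
number (so that the infimum of the empty set is `∞`). -/
def evolutionNorm (Ψ : Evolution U) : EReal :=
  sInf {x : EReal | ∃ c : ℝ, x = (c : EReal) ∧ ∀ t : ℕ, ‖Ψ.state t‖ ≤ c * ‖Ψ.init‖}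

/-- The evolution is stable: its norm is less than `∞`. -/
def Stable (Ψ : Evolution U) : Prop := Ψ.evolutionNorm < ⊤

/-- The state average `(1/t) ∑_{m=1}^t s⁽ᵐ⁾`. -/
def stateAverage (Ψ : Evolution U) (t : ℕ) : U :=
  (t : ℂ)⁻¹ • ∑ m ∈ Finset.Icc 1 t, Ψ.state m

/-- The evolution is mean ergodic: the state averages converge to some limit state in the closed
evolution space. -/
def MeanErgodic (Ψ : Evolution U) : Prop :=
  ∃ l ∈ Ψ.closedSpace, Tendsto Ψ.stateAverage atTop (𝓝 l)

/-- Two evolutions in `U` are equivalent: the distance of their states tends to `0`. -/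
def Equivalent (Φ Ψ : Evolution U) : Prop :=
  Tendsto (fun t : ℕ => ‖Ψ.state t - Φ.state t‖) atTop (𝓝 0)

/-- The evolution is equivalent to a finite-dimensional evolution in `U`. -/
def Finitary (Ψ : Evolution U) : Prop :=
  ∃ Φ : Evolution U, Φ.IsFiniteDimensional ∧ Ψ.Equivalent Φ

/-- `T` is a bounded operator on the closed evolution space that extends the restriction of `ψ`
to the evolution space. -/
def IsExtension (Ψ : Evolution U) (T : Ψ.closedSpace →L[ℂ] Ψ.closedSpace) : Prop :=
  ∀ x : Ψ.closedSpace, (x : U) ∈ Ψ.space → (T x : U) = Ψ.op (x : U)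

end Evolution

section Riesz

variable {V : Type*} [NormedAddCommGroup V] [NormedSpace ℂ V]

/-- The integral `(1/2πi) ∮_{|z - l| = r} (z - T)⁻¹ dz` of the resolvent. If `l` is the only point
of the spectrum of `T` in the closed disc, this is the spectral projection at `l`. -/
def spectralProjection (T : V →L[ℂ] V) (l : ℂ) (r : ℝ) : V →L[ℂ] V :=
  (2 * (Real.pi : ℂ) * Complex.I)⁻¹ • circleIntegral (fun z : ℂ => resolvent T z) l r

/-- `l` has finite algebraic multiplicity for the bounded operator `T` on the Banach space `V`:
it is isolated in the spectrum, and the spectral projection at `l`, whose rank is the algebraic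
multiplicity, has finite rank. (Finite dimension of the space of all `x` with `(T - l)ⁿ x = 0`
for some `n` is a weaker condition on an infinite-dimensional space.) -/
def HasFiniteAlgebraicMultiplicity [CompleteSpace V] (T : V →L[ℂ] V) (l : ℂ) : Prop :=
  ∃ r : ℝ, 0 < r ∧ Metric.closedBall l r ∩ spectrum ℂ T ⊆ {l} ∧
    FiniteDimensional ℂ (spectralProjection T l r).range

/-- A bounded operator is a Riesz operator if every nonzero point of its spectrum is an eigenvalue
of finite algebraic multiplicity and `0` is the only possible accumulation point of the
spectrum. -/
structure IsRieszOperator [CompleteSpace V] (T : V →L[ℂ] V) : Prop where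
  hasEigenvalue : ∀ l ∈ spectrum ℂ T, l ≠ 0 → Module.End.HasEigenvalue (T : V →ₗ[ℂ] V) l
  finiteMultiplicity : ∀ l ∈ spectrum ℂ T, l ≠ 0 → HasFiniteAlgebraicMultiplicity T l
  accPt_eq_zero : ∀ l : ℂ, AccPt l (𝓟 (spectrum ℂ T)) → l = 0

end Riesz

/-- A Riesz evolution: the operator extends to a Riesz operator on the closed evolution space. -/
def Evolution.IsRiesz {U : Type*} [NormedAddCommGroup U] [NormedSpace ℂ U] [CompleteSpace U]
    (Ψ : Evolution U) : Prop :=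
  ∃ T : Ψ.closedSpace →L[ℂ] Ψ.closedSpace, Ψ.IsExtension T ∧ IsRieszOperator T

/-- The average `(1/t) ∑_{m=1}^t Tᵐ v`. -/
def cesaroAverage {V : Type*} [NormedAddCommGroup V] [NormedSpace ℂ V] (T : V →L[ℂ] V) (v : V)
    (t : ℕ) : V :=
  (t : ℂ)⁻¹ • ∑ m ∈ Finset.Icc 1 t, (T ^ m) v

end

/-! ### Inverting `l - T` modulo finite-rank operators -/

section Parametrix

variable {V : Type*} [NormedAddCommGroup V] [NormedSpace ℂ V]

/-! Only finitely many spectral points of a Riesz operator T have modulus at least 1, and their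
spectral projections have finite rank. Hence the space splits T-invariantly into ran Q, of finite
dimension, and ker Q, on which T has its spectrum in the open unit disc; there `T ^ t` tends to 0
and 1 - T is onto (`IsRieszOperator.exists_decomposition`). The contour integrals only serve to
invert l - T modulo finite rank; the projection itself comes from a Fitting decomposition, so
idempotence of the Riesz projections is never needed.

The orbit of s is therefore asymptotic to that of Q s, which makes the evolution finitary, and the
rest is linear algebra on ran Q. Since s is cyclic, the growth of the orbit of Q s controls all of
ran Q (`apply_mem_of_cyclic`). Convergent averages force the t-th state to be o(t). On ran Q this
rules out eigenvalues of modulus greater than 1 and nontrivial Jordan blocks on the unit circle, so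
the orbit is bounded.

Conversely, a bounded orbit of s makes every orbit bounded, and then V = ker (1 - T) + ran (1 - T).
Cesàro averages fix the first summand and tend to 0 on the second; by Banach–Steinhaus their limit
is a bounded projection onto the fixed space. -/

theorem circleIntegral_mul_left {A : Type*} [NormedRing A] [NormedAlgebra ℂ A] [CompleteSpace A]
    (a : A) {f : ℂ → A} {c : ℂ} {R : ℝ} (hf : CircleIntegrable f c R) :
    circleIntegral (fun z => a * f z) c R = a * circleIntegral f c R := by
  have h := (ContinuousLinearMap.mul ℂ A a).intervalIntegral_comp_comm hf.out
  simp only [ContinuousLinearMap.mul_apply', mul_smul_comm] at h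
  simpa only [circleIntegral] using h

theorem circleIntegral_mul_right {A : Type*} [NormedRing A] [NormedAlgebra ℂ A] [CompleteSpace A]
    (a : A) {f : ℂ → A} {c : ℂ} {R : ℝ} (hf : CircleIntegrable f c R) :
    circleIntegral (fun z => f z * a) c R = circleIntegral f c R * a := by
  have h := ((ContinuousLinearMap.mul ℂ A).flip a).intervalIntegral_comp_comm hf.out
  simp only [ContinuousLinearMap.flip_apply, ContinuousLinearMap.mul_apply', smul_mul_assoc] at h
  simpa only [circleIntegral] using h

theorem commute_circleIntegral {A : Type*} [NormedRing A] [NormedAlgebra ℂ A] [CompleteSpace A]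
    {a : A} {f : ℂ → A} {c : ℂ} {R : ℝ} (hR : 0 ≤ R) (hf : CircleIntegrable f c R)
    (h : ∀ z ∈ Metric.sphere c R, Commute a (f z)) : Commute a (circleIntegral f c R) := by
  rw [Commute, SemiconjBy, ← circleIntegral_mul_left a hf, ← circleIntegral_mul_right a hf]
  exact circleIntegral.integral_congr hR fun z hz => (h z hz).eq

theorem resolvent_commute {A : Type*} [Ring A] [Algebra ℂ A] {a b : A} (h : Commute b a) (z : ℂ) :
    Commute b (resolvent a z) := by
  have h' : Commute b (algebraMap ℂ A z - a) := (Algebra.commute_algebraMap_right z b).sub_right h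
  by_cases hu : IsUnit (algebraMap ℂ A z - a)
  · obtain ⟨u, hu⟩ := hu
    rw [resolvent, ← hu, Ring.inverse_unit]
    exact Commute.units_inv_right (hu ▸ h')
  · rw [resolvent, Ring.inverse_non_unit _ hu]
    exact Commute.zero_right b

/-- If the spectral projection `P` at `l` is defined, then `l - T` is invertible modulo `P`. -/
theorem exists_parametrix_spectralProjection [CompleteSpace V] (T : V →L[ℂ] V) {l : ℂ} {r : ℝ}
    (hr : 0 < r) (h : Metric.closedBall l r ∩ spectrum ℂ T ⊆ {l}) :
    (∀ B, Commute B T → Commute B (spectralProjection T l r)) ∧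
    ∃ S : V →L[ℂ] V, (algebraMap ℂ _ l - T) * S = 1 - spectralProjection T l r ∧
      ∀ B, Commute B T → Commute B S := by
  have hsph : ∀ z ∈ Metric.sphere l r, z ∈ resolventSet ℂ T := by
    intro z hz
    by_contra hz'
    have := h ⟨Metric.sphere_subset_closedBall hz, hz'⟩
    rw [Set.mem_singleton_iff] at this
    subst this
    simp at hz
    exact hr.ne hz
  have hne : ∀ z ∈ Metric.sphere l r, z - l ≠ 0 := by
    intro z hz h0
    rw [sub_eq_zero] at h0
    subst h0
    simp at hz
    exact hr.ne hz
  have hc : ContinuousOn (fun z : ℂ => resolvent T z) (Metric.sphere l r) := fun z hz =>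
    (spectrum.hasDerivAt_resolvent_const_left (hsph z hz)).continuousAt.continuousWithinAt
  have hci : ContinuousOn (fun z : ℂ => (z - l)⁻¹) (Metric.sphere l r) :=
    ContinuousOn.inv₀ (by fun_prop) hne
  have hcd : ContinuousOn (fun z : ℂ => (z - l)⁻¹ • resolvent T z) (Metric.sphere l r) :=
    hci.smul hc
  have hI := hc.circleIntegrable hr.le
  have hId := hcd.circleIntegrable hr.le
  have hIi : CircleIntegrable (fun z : ℂ => (z - l)⁻¹ • (1 : V →L[ℂ] V)) l r :=
    (hci.smul continuousOn_const).circleIntegrable hr.le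
  -- The witness S is the contour integral of the resolvent divided by z - l.
  refine ⟨fun B hB => (commute_circleIntegral hr.le hI fun z _ => resolvent_commute hB z).smul_right _,
    (2 * (Real.pi : ℂ) * Complex.I)⁻¹ •
      circleIntegral (fun z : ℂ => (z - l)⁻¹ • resolvent T z) l r, ?_,
    fun B hB => (commute_circleIntegral hr.le hId
      fun z _ => (resolvent_commute hB z).smul_right _).smul_right _⟩
  -- Writing l - T = (z - T) - (z - l) turns the integrand into 1/(z - l) minus the resolvent, which
  -- integrates to 2πi (1 - P).
  have key : circleIntegral (fun z : ℂ => (algebraMap ℂ (V →L[ℂ] V) l - T) *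
      ((z - l)⁻¹ • resolvent T z)) l r =
      circleIntegral (fun z : ℂ => (z - l)⁻¹ • (1 : V →L[ℂ] V) - resolvent T z) l r := by
    refine circleIntegral.integral_congr hr.le fun z hz => ?_
    have h1 : (algebraMap ℂ (V →L[ℂ] V) z - T) * resolvent T z = 1 :=
      Ring.mul_inverse_cancel _ (hsph z hz)
    have h2 : algebraMap ℂ (V →L[ℂ] V) l - T =
        (algebraMap ℂ (V →L[ℂ] V) z - T) - (z - l) • 1 := by
      rw [← Algebra.algebraMap_eq_smul_one, map_sub]; abel
    show (algebraMap ℂ (V →L[ℂ] V) l - T) * ((z - l)⁻¹ • resolvent T z) = _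
    rw [mul_smul_comm, h2, sub_mul, h1, smul_mul_assoc, one_mul, smul_sub, smul_smul,
      inv_mul_cancel₀ (hne z hz), one_smul]
  rw [circleIntegral_mul_left _ hId, circleIntegral.integral_sub hIi hI,
    circleIntegral.integral_smul_const, circleIntegral.integral_sub_center_inv _ hr.ne'] at key
  rw [mul_smul_comm, key, smul_sub, smul_smul, inv_mul_cancel₀ Complex.two_pi_I_ne_zero,
    one_smul, spectralProjection]

theorem finiteDimensional_range_mul_left {P : V →L[ℂ] V} [FiniteDimensional ℂ P.range]
    (B : V →L[ℂ] V) : FiniteDimensional ℂ (P * B).range :=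
  Submodule.finiteDimensional_of_le (S₂ := P.range) (by
    rintro _ ⟨x, rfl⟩; exact ⟨B x, rfl⟩)

/-- A single finite-rank operator modulo which all `l - T`, `l ∈ s`, are invertible. -/
theorem exists_common_parametrix [CompleteSpace V] (T : V →L[ℂ] V) {s : Set ℂ} (hs : s.Finite)
    (h : ∀ l ∈ s, HasFiniteAlgebraicMultiplicity T l) :
    ∃ P : V →L[ℂ] V, FiniteDimensional ℂ P.range ∧ (∀ B, Commute B T → Commute B P) ∧
      ∀ l ∈ s, ∃ S : V →L[ℂ] V, (algebraMap ℂ _ l - T) * S = 1 - P ∧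
        ∀ B, Commute B T → Commute B S := by
  induction s, hs using Set.Finite.induction_on with
  | empty =>
    refine ⟨0, ?_, fun B _ => Commute.zero_right B, by simp⟩
    have : (0 : V →L[ℂ] V).range = ⊥ := by ext; simp
    rw [this]; infer_instance
  | @insert a s ha hs ih =>
    obtain ⟨P, hP, hPc, hPs⟩ := ih fun l hl => h l (Set.mem_insert_of_mem _ hl)
    obtain ⟨r, hr, hball, hfin⟩ := h a (Set.mem_insert _ _)
    obtain ⟨hQc, S, hS, hSc⟩ := exists_parametrix_spectralProjection T hr hball
    generalize spectralProjection T a r = Q at *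
    have hQT : Commute Q T := (hQc T (Commute.refl T)).symm
    have hPT : Commute P T := (hPc T (Commute.refl T)).symm
    -- This choice makes 1 minus the new operator equal to (1 - P)(1 - Q), so that invertibility
    -- modulo P and modulo Q both pass to it.
    refine ⟨P * (1 - Q) + Q, ?_, fun B hB => ((hPc B hB).mul_right
      ((Commute.one_right B).sub_right (hQc B hB))).add_right (hQc B hB), ?_⟩
    · have := finiteDimensional_range_mul_left (P := P) (1 - Q)
      refine Submodule.finiteDimensional_of_le (S₂ := (P * (1 - Q)).range ⊔ Q.range) ?_
      rintro _ ⟨x, rfl⟩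
      exact Submodule.add_mem_sup ⟨x, rfl⟩ ⟨x, rfl⟩
    · intro l hl
      rcases Set.mem_insert_iff.1 hl with rfl | hl
      · refine ⟨S * (1 - P), ?_, fun B hB => (hSc B hB).mul_right
          ((Commute.one_right B).sub_right (hPc B hB))⟩
        rw [← mul_assoc, hS, sub_mul, mul_sub, mul_sub, mul_sub, (hPc Q hQT).eq]
        simp only [mul_one, one_mul]; abel
      · obtain ⟨S', hS', hSc'⟩ := hPs l hl
        refine ⟨S' * (1 - Q), ?_, fun B hB => (hSc' B hB).mul_right
          ((Commute.one_right B).sub_right (hQc B hB))⟩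
        rw [← mul_assoc, hS', sub_mul, one_mul, ← sub_sub]; abel

/-- Fitting decomposition for an endomorphism of finite rank. -/
theorem exists_isCompl_ker_pow_range_pow {K M : Type*} [Field K] [AddCommGroup M] [Module K M]
    (P : M →ₗ[K] M) [FiniteDimensional K P.range] :
    ∃ n : ℕ, FiniteDimensional K (P ^ n).range ∧ IsCompl (P ^ n).range (P ^ n).ker := by
  have hmono : ∀ {m n : ℕ}, m ≤ n → (P ^ n).range ≤ (P ^ m).range := by
    rintro m n hmn _ ⟨x, rfl⟩
    exact ⟨(P ^ (n - m)) x, by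
      rw [← Module.End.mul_apply, ← pow_add, Nat.add_sub_cancel' hmn]⟩
  have hfd : ∀ n, 1 ≤ n → FiniteDimensional K (P ^ n).range := fun n hn =>
    Submodule.finiteDimensional_of_le (S₂ := P.range) (by simpa using hmono hn)
  obtain ⟨n, hn⟩ : ∃ n, 1 ≤ n ∧ (P ^ (n + n)).range = (P ^ n).range := by
    -- The rank is minimized over n ≥ 1 only: `P ^ 0` may have infinite rank, for which `finrank`
    -- returns 0.
    obtain ⟨n, hn, hmin⟩ : ∃ n, 1 ≤ n ∧ ∀ m, 1 ≤ m →
        Module.finrank K (P ^ n).range ≤ Module.finrank K (P ^ m).range := by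
      obtain ⟨n, hn, hmin⟩ := (wellFounded_lt (α := ℕ)).has_min
        ((fun n => Module.finrank K (P ^ n).range) '' Set.Ici 1) ⟨_, 1, Set.mem_Ici.2 le_rfl, rfl⟩
      obtain ⟨k, hk, rfl⟩ := hn
      exact ⟨k, hk, fun m hm => not_lt.1 (hmin _ ⟨m, hm, rfl⟩)⟩
    have := hfd n hn
    exact ⟨n, hn, Submodule.eq_of_le_of_finrank_le (hmono (by omega)) (hmin _ (by omega))⟩
  have := hfd n hn.1
  refine ⟨n, this, ?_⟩
  have hinv : ∀ x ∈ (P ^ n).range, (P ^ n) x ∈ (P ^ n).range := fun x _ => ⟨x, rfl⟩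
  have hsurj : Function.Surjective ((P ^ n).restrict hinv) := by
    rintro ⟨y, hy⟩
    rw [← hn.2] at hy
    obtain ⟨x, rfl⟩ := hy
    refine ⟨⟨(P ^ n) x, x, rfl⟩, Subtype.ext ?_⟩
    simp [pow_add]
  have hinj := LinearMap.injective_iff_surjective.2 hsurj
  refine IsCompl.of_eq ?_ ?_
  · rw [Submodule.eq_bot_iff]
    rintro x ⟨hx, hx0⟩
    have := @hinj ⟨x, hx⟩ 0 (Subtype.ext (by simpa using hx0))
    simpa using this
  · rw [Submodule.eq_top_iff']
    intro x
    have hx : (P ^ n) x ∈ (P ^ (n + n)).range := hn.2 ▸ ⟨x, rfl⟩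
    obtain ⟨y, hy⟩ := hx
    rw [← add_sub_cancel ((P ^ n) y) x]
    refine Submodule.add_mem_sup ⟨y, rfl⟩ ?_
    rw [LinearMap.mem_ker, map_sub, ← hy, pow_add, Module.End.mul_apply, sub_self]

/-- The spectrum is compact, so the spectral radius is below 1, and Gelfand's formula bounds the
norms of the powers by a geometric sequence. -/
theorem tendsto_pow_of_norm_spectrum_lt_one {A : Type*} [NormedRing A] [NormedAlgebra ℂ A]
    [CompleteSpace A] (a : A) (h : ∀ z ∈ spectrum ℂ a, ‖z‖ < 1) :
    Tendsto (fun n : ℕ => a ^ n) atTop (𝓝 0) := by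
  have hlt : spectralRadius ℂ a < 1 := by
    rcases (spectrum ℂ a).eq_empty_or_nonempty with h0 | h0
    · simp [spectralRadius, h0]
    · exact_mod_cast spectrum.spectralRadius_lt_of_forall_lt_of_nonempty (r := 1) h0
        (fun z hz => by exact_mod_cast h z hz)
  obtain ⟨ρ, hρ, hρ1⟩ := ENNReal.lt_iff_exists_nnreal_btwn.1 hlt
  have hev := (spectrum.pow_nnnorm_pow_one_div_tendsto_nhds_spectralRadius a).eventually_lt_const hρ
  have hρ1' : ρ < 1 := by exact_mod_cast hρ1
  refine squeeze_zero_norm' ?_ (tendsto_pow_atTop_nhds_zero_of_lt_one ρ.2 (by exact_mod_cast hρ1'))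
  filter_upwards [hev, eventually_ge_atTop 1] with n hn hn1
  have hn0 : (0 : ℝ) < n := by exact_mod_cast hn1
  have := ENNReal.rpow_le_rpow hn.le hn0.le
  rw [← ENNReal.rpow_mul, one_div, inv_mul_cancel₀ hn0.ne', ENNReal.rpow_one,
    ENNReal.rpow_natCast] at this
  exact_mod_cast this

/-- An infinite subset of this compact set would accumulate at a point of modulus at least 1, but
only 0 may be an accumulation point. -/
theorem IsRieszOperator.finite_spectrum [CompleteSpace V] {T : V →L[ℂ] V} (hT : IsRieszOperator T) :
    {l ∈ spectrum ℂ T | 1 ≤ ‖l‖}.Finite := by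
  by_contra hinf
  have hK : IsCompact {l ∈ spectrum ℂ T | 1 ≤ ‖l‖} :=
    (spectrum.isCompact T).inter_right (isClosed_le continuous_const continuous_norm)
  obtain ⟨x, hx, hacc⟩ := Set.Infinite.exists_accPt_of_subset_isCompact hinf hK subset_rfl
  have := hT.accPt_eq_zero x (hacc.mono (principal_mono.2 (Set.sep_subset _ _)))
  rw [this] at hx
  have := hx.2
  simp at this
  linarith

end Parametrix

/-! ### Splitting off the finite-dimensional part of a Riesz operator -/

section Decomposition

variable {V : Type*} [NormedAddCommGroup V] [NormedSpace ℂ V]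

theorem exists_isIdempotentElem_of_isCompl_range_ker [CompleteSpace V] (K : V →L[ℂ] V)
    [FiniteDimensional ℂ K.range] (h : IsCompl K.range K.ker) :
    ∃ Q : V →L[ℂ] V, IsIdempotentElem Q ∧ FiniteDimensional ℂ Q.range ∧
      (∀ v, Q v = 0 ↔ K v = 0) ∧ ∀ T, Commute T K → Commute Q T := by
  have hF : IsClosed (K.range : Set V) := Submodule.closed_of_finiteDimensional _
  have hW : IsClosed (K.ker : Set V) := K.isClosed_ker
  let p := Submodule.projectionOntoL K.range K.ker (Submodule.IsCompl.isTopCompl_of_isClosed h hF hW)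
  have hp1 : ∀ x : K.range, p x = x := fun x => by
    simp [p]
  have hp0 : ∀ x, p x = 0 ↔ K x = 0 := fun x => by
    simp [p]
  refine ⟨K.range.subtypeL ∘L p, ?_, ?_, ?_, ?_⟩
  · ext v
    simp [hp1]
  · refine Submodule.finiteDimensional_of_le (S₂ := K.range) ?_
    rintro _ ⟨x, rfl⟩
    exact (p x).2
  · intro v
    simp [hp0]
  · intro T hT
    have hTK : ∀ x, T (K x) = K (T x) := fun x => congrArg (fun f : V →L[ℂ] V => f x) hT.eq
    ext v
    -- T preserves both the kernel and the range of K, hence commutes with the projection that they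
    -- define.
    have hker : p (T (v - p v)) = 0 := by
      rw [hp0, ← hTK, (hp0 _).1, map_zero]
      rw [map_sub, hp1, sub_self]
    obtain ⟨y, hy⟩ := (p v).2
    have hmem : T (p v) ∈ K.range := ⟨T y, by rw [← hy]; exact (hTK y).symm⟩
    have h1 := hp1 ⟨T (p v), hmem⟩
    rw [map_sub, map_sub, sub_eq_zero] at hker
    show ((p (T v) : K.range) : V) = T (p v)
    rw [hker]
    exact congrArg Subtype.val h1

/-- A Riesz operator splits into a finite-dimensional part and a part of spectral radius less
than `1`. -/
theorem IsRieszOperator.exists_decomposition [CompleteSpace V] {T : V →L[ℂ] V}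
    (hT : IsRieszOperator T) :
    ∃ Q : V →L[ℂ] V, IsIdempotentElem Q ∧ FiniteDimensional ℂ Q.range ∧ Commute Q T ∧
      (∀ v, Q v = 0 → Tendsto (fun t : ℕ => (T ^ t) v) atTop (𝓝 0)) ∧
      ∀ v, Q v = 0 → ∃ w, w - T w = v := by
  obtain ⟨P, hPfin, hPc, hPs⟩ := exists_common_parametrix T hT.finite_spectrum fun l hl =>
    hT.finiteMultiplicity l hl.1 (by rintro rfl; have := hl.2; simp at this; linarith)
  obtain ⟨n, hKfin, hKc⟩ := exists_isCompl_ker_pow_range_pow (P : V →ₗ[ℂ] V)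
  have hcoe : ((P ^ n : V →L[ℂ] V) : V →ₗ[ℂ] V) = (P : V →ₗ[ℂ] V) ^ n := by
    ext; simp
  -- Invertibility modulo P implies invertibility modulo `P ^ n`, because 1 - P divides 1 - `P ^ n`
  -- through the geometric sum.
  have hinv : ∀ l : ℂ, 1 ≤ ‖l‖ → ∃ S : V →L[ℂ] V, (algebraMap ℂ _ l - T) * S = 1 - P ^ n ∧
        ∀ B, Commute B T → Commute B S := by
    intro l hl
    by_cases hls : l ∈ spectrum ℂ T
    · obtain ⟨S, hS, hSc⟩ := hPs l ⟨hls, hl⟩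
      refine ⟨S * ∑ i ∈ Finset.range n, P ^ i, ?_, fun B hB => (hSc B hB).mul_right
        (Commute.sum_right _ _ _ fun i _ => (hPc B hB).pow_right i)⟩
      rw [← mul_assoc, hS, mul_neg_geom_sum]
    · have hu : IsUnit (algebraMap ℂ (V →L[ℂ] V) l - T) := not_not.1 hls
      refine ⟨resolvent T l * (1 - P ^ n), ?_, fun B hB => (resolvent_commute hB l).mul_right
        ((Commute.one_right B).sub_right ((hPc B hB).pow_right n))⟩
      rw [resolvent, ← mul_assoc, Ring.mul_inverse_cancel _ hu, one_mul]
  have hKT : Commute T (P ^ n) := (hPc T (Commute.refl T)).pow_right n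
  rw [← hcoe] at hKfin hKc
  generalize P ^ n = K at *
  obtain ⟨Q, hQ, hQfin, hQ0, hQT⟩ := exists_isIdempotentElem_of_isCompl_range_ker K hKc
  have hmaps : ∀ B : V →L[ℂ] V, Commute B K → ∀ x ∈ K.ker, B x ∈ K.ker := by
    intro B hB x hx
    have : K (B x) = B (K x) := congrArg (fun f : V →L[ℂ] V => f x) hB.eq.symm
    have hx' : K x = 0 := hx
    show K (B x) = 0
    rw [this, hx', map_zero]
  have : CompleteSpace K.ker := K.isClosed_ker.completeSpace_coe
  let TW : K.ker →L[ℂ] K.ker := T.restrict (hmaps T hKT)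
  have hTW : ∀ x : K.ker, (TW x : V) = T x := fun x => rfl
  -- On ker K the operator 1 - K is the identity, so S restricts to a genuine two-sided inverse.
  have hspec : ∀ l : ℂ, 1 ≤ ‖l‖ → IsUnit (algebraMap ℂ (K.ker →L[ℂ] K.ker) l - TW) := by
    intro l hl
    obtain ⟨S, hS, hSc⟩ := hinv l hl
    have hST : Commute T S := hSc T (Commute.refl T)
    have hTK : Commute K S := hSc K hKT.symm
    let SW : K.ker →L[ℂ] K.ker := S.restrict (hmaps S hTK.symm)
    have hS' : S * (algebraMap ℂ _ l - T) = 1 - K := by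
      rw [← hS]
      exact ((Algebra.commute_algebraMap_right l S).sub_right hST.symm).eq
    refine isUnit_iff_exists.2 ⟨SW, ?_, ?_⟩
    · ext x
      have h1 := congrArg (fun f : V →L[ℂ] V => f x) hS
      have h2 : K x = 0 := x.2
      simpa [TW, SW, h2] using h1
    · ext x
      have h1 := congrArg (fun f : V →L[ℂ] V => f x) hS'
      have h2 : K x = 0 := x.2
      simpa [TW, SW, h2] using h1
  refine ⟨Q, hQ, hQfin, hQT T hKT, fun v hv => ?_, fun v hv => ?_⟩
  · have hlim := tendsto_pow_of_norm_spectrum_lt_one TW fun z hz => by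
      by_contra hz1
      exact hz (hspec z (not_lt.1 hz1))
    have hpow : ∀ t : ℕ, ∀ x : K.ker, ((TW ^ t) x : V) = (T ^ t) x := by
      intro t
      induction t with
      | zero => intro x; rfl
      | succ t ih => intro x; rw [pow_succ, pow_succ]; exact ih (TW x)
    let w : K.ker := ⟨v, (hQ0 v).1 hv⟩
    have h1 : Tendsto (fun t : ℕ => ((TW ^ t) w : V)) atTop (𝓝 0) := by
      have := ((K.ker.subtypeL ∘L ContinuousLinearMap.apply ℂ K.ker w).continuous.tendsto 0).comp
        hlim
      rwa [map_zero] at this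
    simpa only [hpow] using h1
  · obtain ⟨u, hu⟩ := hspec 1 (by simp)
    let w : K.ker := ⟨v, (hQ0 v).1 hv⟩
    refine ⟨(((u⁻¹ : (K.ker →L[ℂ] K.ker)ˣ) : K.ker →L[ℂ] K.ker) w : K.ker), ?_⟩
    have h1 : (u : K.ker →L[ℂ] K.ker) (((u⁻¹ : (K.ker →L[ℂ] K.ker)ˣ) : K.ker →L[ℂ] K.ker) w) = w := by
      rw [← mul_apply_eq_comp, Units.mul_inv, one_apply_eq_self]
    rw [hu, map_one] at h1
    exact congrArg Subtype.val h1

end Decomposition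

/-! ### Bounded and sublinear orbits in finite dimension -/

section Orbits

variable {V : Type*} [NormedAddCommGroup V] [NormedSpace ℂ V]

/-- The vectors with bounded orbit. -/
def boundedOrbits (B : Module.End ℂ V) : Submodule ℂ V where
  carrier := {x | ∃ C : ℝ, ∀ t : ℕ, ‖(B ^ t) x‖ ≤ C}
  zero_mem' := ⟨0, by simp⟩
  add_mem' := by
    rintro x y ⟨C, hC⟩ ⟨D, hD⟩
    refine ⟨C + D, fun t => ?_⟩
    rw [map_add]
    exact (norm_add_le _ _).trans (add_le_add (hC t) (hD t))
  smul_mem' := by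
    rintro c x ⟨C, hC⟩
    refine ⟨‖c‖ * C, fun t => ?_⟩
    rw [map_smul, norm_smul]
    exact mul_le_mul_of_nonneg_left (hC t) (norm_nonneg c)

/-- The vectors whose orbit grows slower than linearly. -/
def sublinearOrbits (B : Module.End ℂ V) : Submodule ℂ V where
  carrier := {x | Tendsto (fun t : ℕ => (t : ℂ)⁻¹ • (B ^ t) x) atTop (𝓝 0)}
  zero_mem' := by simp
  add_mem' := by
    intro x y hx hy
    simpa using Tendsto.add hx hy
  smul_mem' := by
    intro c x hx
    have := Tendsto.const_smul hx c
    simpa [smul_comm c] using this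

theorem mem_boundedOrbits {B : Module.End ℂ V} {x : V} :
    x ∈ boundedOrbits B ↔ ∃ C : ℝ, ∀ t : ℕ, ‖(B ^ t) x‖ ≤ C := Iff.rfl

theorem mem_sublinearOrbits {B : Module.End ℂ V} {x : V} :
    x ∈ sublinearOrbits B ↔ Tendsto (fun t : ℕ => (t : ℂ)⁻¹ • (B ^ t) x) atTop (𝓝 0) := Iff.rfl

theorem map_mem_boundedOrbits {B : Module.End ℂ V} {x : V} (hx : x ∈ boundedOrbits B) :
    B x ∈ boundedOrbits B := by
  obtain ⟨C, hC⟩ := hx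
  exact ⟨C, fun t => by simpa [pow_succ] using hC (t + 1)⟩

theorem tendsto_inv_smul_zero {E : Type*} [NormedAddCommGroup E] [NormedSpace ℂ E] {u : ℕ → E}
    {C : ℝ} (h : ∀ t, ‖u t‖ ≤ C) : Tendsto (fun t : ℕ => (t : ℂ)⁻¹ • u t) atTop (𝓝 0) :=
  (tendsto_inv_atTop_nhds_zero_nat (𝕜 := ℂ)).zero_smul_isBoundedUnder_le
    ⟨C, eventually_map.2 (Eventually.of_forall h)⟩

theorem boundedOrbits_le_sublinearOrbits (B : Module.End ℂ V) :
    boundedOrbits B ≤ sublinearOrbits B := by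
  rintro x ⟨C, hC⟩
  exact tendsto_inv_smul_zero hC

theorem tendsto_succ_div_atTop : Tendsto (fun t : ℕ => (t : ℂ)⁻¹ * ((t + 1 : ℕ) : ℂ)) atTop (𝓝 1) := by
  have h : Tendsto (fun t : ℕ => 1 + (t : ℂ)⁻¹) atTop (𝓝 (1 + 0)) :=
    tendsto_const_nhds.add (tendsto_inv_atTop_nhds_zero_nat (𝕜 := ℂ))
  rw [add_zero] at h
  refine h.congr' ?_
  filter_upwards [eventually_ge_atTop 1] with t ht
  have : (t : ℂ) ≠ 0 := by exact_mod_cast (by omega : t ≠ 0)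
  push_cast
  field_simp

theorem map_mem_sublinearOrbits {B : Module.End ℂ V} {x : V} (hx : x ∈ sublinearOrbits B) :
    B x ∈ sublinearOrbits B := by
  rw [mem_sublinearOrbits] at *
  have h := tendsto_succ_div_atTop.smul (hx.comp (tendsto_add_atTop_nat 1))
  rw [smul_zero] at h
  refine h.congr fun t => ?_
  have : ((t + 1 : ℕ) : ℂ) ≠ 0 := by exact_mod_cast Nat.succ_ne_zero t
  simp only [Function.comp_apply, smul_smul, mul_assoc, mul_inv_cancel₀ this, mul_one]
  rw [pow_succ]; rfl

theorem pow_apply_of_eigenvector {B : Module.End ℂ V} {l : ℂ} {x : V} (h : B x = l • x) (t : ℕ) :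
    (B ^ t) x = l ^ t • x := by
  induction t with
  | zero => simp
  | succ t ih => rw [pow_succ, Module.End.mul_apply, h, map_smul, ih, smul_smul, pow_succ']

theorem norm_eigenvalue_le_one {B : Module.End ℂ V} {l : ℂ} {x : V} (h : B x = l • x)
    (hx0 : x ≠ 0) (hx : x ∈ sublinearOrbits B) : ‖l‖ ≤ 1 := by
  by_contra! hl
  have h1 := hx.norm
  simp only [pow_apply_of_eigenvector h, norm_smul, norm_inv, norm_pow, norm_zero,
    Complex.norm_natCast] at h1
  obtain ⟨ε, hε⟩ : ∃ ε, ‖l‖ = 1 + ε := ⟨‖l‖ - 1, by ring⟩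
  have hε0 : 0 < ε := by linarith
  have hxn : 0 < ‖x‖ := norm_pos_iff.2 hx0
  -- By Bernoulli, (1 + ε)^t ≥ 1 + tε, so division by t leaves at least ε.
  have hlow : ∀ᶠ t : ℕ in atTop, ε * ‖x‖ ≤ (t : ℝ)⁻¹ * (‖l‖ ^ t * ‖x‖) := by
    filter_upwards [eventually_ge_atTop 1] with t ht
    have ht0 : (0 : ℝ) < t := by exact_mod_cast ht
    have hb := one_add_mul_le_pow (a := ε) (by linarith) t
    rw [← mul_assoc, hε]
    refine mul_le_mul_of_nonneg_right ?_ hxn.le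
    rw [← div_eq_inv_mul, le_div_iff₀ ht0]
    linarith
  have := ge_of_tendsto h1 hlow
  have := mul_pos hε0 hxn
  linarith

theorem pow_apply_of_jordan {B : Module.End ℂ V} {l : ℂ} {x y : V} (h : B x = l • x + y)
    (hy : B y = l • y) (t : ℕ) :
    (B ^ (t + 1)) x = l ^ (t + 1) • x + ((t + 1 : ℕ) * l ^ t) • y := by
  induction t with
  | zero => simp [h]
  | succ t ih =>
    rw [pow_succ', Module.End.mul_apply, ih, map_add, map_smul, map_smul, h, hy]
    push_cast
    module

/-- There are no Jordan blocks of size `2` to an eigenvalue of modulus `1`. -/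
theorem eq_zero_of_jordan {B : Module.End ℂ V} {l : ℂ} {x y : V} (h : B x = l • x + y)
    (hy : B y = l • y) (hl : ‖l‖ = 1) (hx : x ∈ sublinearOrbits B) : y = 0 := by
  have h1 := hx.comp (tendsto_add_atTop_nat 1)
  have h2 : Tendsto (fun t : ℕ => (t : ℂ)⁻¹ • (l ^ t • x)) atTop (𝓝 0) :=
    tendsto_inv_smul_zero (C := ‖x‖) fun t => by simp [norm_smul, hl]
  have h3 := (h1.sub (h2.comp (tendsto_add_atTop_nat 1))).norm
  -- After removal of the bounded term the quotient is `l ^ t • y`, of constant norm.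
  have h4 : ∀ t : ℕ, ‖((fun t : ℕ => (t : ℂ)⁻¹ • (B ^ t) x) ∘ fun a => a + 1) t -
      ((fun t : ℕ => (t : ℂ)⁻¹ • (l ^ t • x)) ∘ fun a => a + 1) t‖ = ‖y‖ := by
    intro t
    have : ((t + 1 : ℕ) : ℂ) ≠ 0 := by exact_mod_cast Nat.succ_ne_zero t
    simp only [Function.comp_apply]
    rw [pow_apply_of_jordan h hy, ← smul_sub, add_sub_cancel_left, smul_smul, ← mul_assoc,
      inv_mul_cancel₀ this, one_mul, norm_smul, norm_pow, hl, one_pow, one_mul]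
  simp only [h4, sub_zero, norm_zero] at h3
  exact norm_eq_zero.1 (tendsto_nhds_unique tendsto_const_nhds h3)

theorem mem_boundedOrbits_of_contracting {B : Module.End ℂ V} {l : ℂ} {x y : V}
    (h : B x = l • x + y) (hl : ‖l‖ < 1) (hy : y ∈ boundedOrbits B) : x ∈ boundedOrbits B := by
  obtain ⟨C, hC⟩ := hy
  have hC0 : 0 ≤ C := (norm_nonneg _).trans (hC 0)
  -- C / (1 - ‖l‖) is the fixed point of a ↦ ‖l‖ a + C, the recursion that bounds the orbit.
  refine ⟨‖x‖ + C / (1 - ‖l‖), fun t => ?_⟩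
  have h1 : 0 < 1 - ‖l‖ := by linarith
  induction t with
  | zero => simpa using div_nonneg hC0 h1.le
  | succ t ih =>
    rw [pow_succ, Module.End.mul_apply, h, map_add, map_smul]
    have h2 : ‖l • (B ^ t) x + (B ^ t) y‖ ≤ ‖l‖ * (‖x‖ + C / (1 - ‖l‖)) + C := by
      refine (norm_add_le _ _).trans (add_le_add ?_ (hC t))
      rw [norm_smul]
      exact mul_le_mul_of_nonneg_left ih (norm_nonneg _)
    have h3 : ‖l‖ * (C / (1 - ‖l‖)) + C = C / (1 - ‖l‖) := by field_simp; ring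
    have h4 : ‖l‖ * ‖x‖ ≤ ‖x‖ := mul_le_of_le_one_left (norm_nonneg _) hl.le
    linarith

/-- The induction applies to y = (B - l) x and needs all three conclusions at once: boundedness of y
if ‖l‖ < 1, that y is an eigenvector if ‖l‖ = 1 (so that the Jordan argument gives y = 0), and ‖l‖ ≤
1 if y ≠ 0. -/
theorem genEigenvector_mem_boundedOrbits {B : Module.End ℂ V}
    (hB : ∀ x, x ∈ sublinearOrbits B) (l : ℂ) (k : ℕ) :
    ∀ x, ((B - algebraMap ℂ _ l) ^ k) x = 0 →
      x ∈ boundedOrbits B ∧ (‖l‖ = 1 → B x = l • x) ∧ (x ≠ 0 → ‖l‖ ≤ 1) := by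
  induction k with
  | zero => intro x hx; simp at hx; subst hx; simp
  | succ k ih =>
    intro x hx
    by_cases hx0 : x = 0
    · subst hx0; simp
    obtain ⟨y, hy⟩ : ∃ y, y = (B - algebraMap ℂ _ l) x := ⟨_, rfl⟩
    rw [pow_succ, Module.End.mul_apply, ← hy] at hx
    have hBx : B x = l • x + y := by rw [hy]; simp [Module.algebraMap_end_apply]
    obtain ⟨hyb, hye, hyl⟩ := ih y hx
    have hl1 : ‖l‖ ≤ 1 := by
      by_cases hy0 : y = 0
      · rw [hy0, add_zero] at hBx
        exact norm_eigenvalue_le_one hBx hx0 (hB x)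
      · exact hyl hy0
    rcases hl1.lt_or_eq with hl | hl
    · exact ⟨mem_boundedOrbits_of_contracting hBx hl hyb, fun h => absurd h hl.ne, fun _ => hl1⟩
    · have hy0 := eq_zero_of_jordan hBx (hye hl) hl (hB x)
      rw [hy0, add_zero] at hBx
      exact ⟨⟨‖x‖, fun t => by simp [pow_apply_of_eigenvector hBx, norm_smul, hl]⟩, fun _ => hBx,
        fun _ => hl1⟩

theorem mem_boundedOrbits_of_finiteDimensional [FiniteDimensional ℂ V] {B : Module.End ℂ V}
    (hB : ∀ x, x ∈ sublinearOrbits B) (x : V) : x ∈ boundedOrbits B := by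
  have : (⊤ : Submodule ℂ V) ≤ boundedOrbits B := by
    rw [← Module.End.iSup_maxGenEigenspace_eq_top B, iSup_le_iff]
    intro l y hy
    obtain ⟨k, hk⟩ := (Module.End.mem_maxGenEigenspace B l y).1 hy
    exact (genEigenvector_mem_boundedOrbits hB l k y
      (by simpa [Algebra.algebraMap_eq_smul_one] using hk)).1
  exact this trivial

end Orbits

/-! ### The mean ergodic theorem -/

section MeanErgodic

variable {V : Type*} [NormedAddCommGroup V] [NormedSpace ℂ V]

theorem sum_Icc_pow_apply_sub (T : V →L[ℂ] V) (w : V) (t : ℕ) :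
    ∑ m ∈ Finset.Icc 1 t, (T ^ m) (w - T w) = T w - (T ^ (t + 1)) w := by
  induction t with
  | zero => simp
  | succ t ih =>
    rw [Finset.sum_Icc_succ_top (by omega), ih, map_sub, pow_succ T (t + 1)]
    show _ + (_ - (T ^ (t + 1)) (T w)) = _ - (T ^ (t + 1)) (T w)
    abel

theorem cesaroAverage_tendsto_of_fixed {T : V →L[ℂ] V} {v : V} (h : T v = v) :
    Tendsto (cesaroAverage T v) atTop (𝓝 v) := by
  have hp : ∀ m : ℕ, (T ^ m) v = v := by
    intro m
    induction m with
    | zero => rfl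
    | succ m ih => rw [pow_succ]; show (T ^ m) (T v) = v; rw [h, ih]
  refine tendsto_const_nhds.congr' ?_
  filter_upwards [eventually_ge_atTop 1] with t ht
  have : (t : ℂ) ≠ 0 := by exact_mod_cast (by omega : t ≠ 0)
  simp only [cesaroAverage, hp, Finset.sum_const, Nat.card_Icc, Nat.add_sub_cancel]
  rw [← Nat.cast_smul_eq_nsmul ℂ, smul_smul, inv_mul_cancel₀ this, one_smul]

theorem cesaroAverage_add (T : V →L[ℂ] V) (v w : V) (t : ℕ) :
    cesaroAverage T (v + w) t = cesaroAverage T v t + cesaroAverage T w t := by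
  simp [cesaroAverage, Finset.sum_add_distrib]

theorem cesaroAverage_tendsto_of_sub {T : V →L[ℂ] V} {w : V}
    (h : w ∈ boundedOrbits (T : V →ₗ[ℂ] V)) :
    Tendsto (cesaroAverage T (w - T w)) atTop (𝓝 0) := by
  obtain ⟨C, hC⟩ := h
  have hC' : ∀ t : ℕ, ‖(T ^ t) w‖ ≤ C := fun t => by
    rw [← ContinuousLinearMap.coe_coe, ContinuousLinearMap.toLinearMap_pow]
    exact hC t
  unfold cesaroAverage
  simp only [sum_Icc_pow_apply_sub]
  refine tendsto_inv_smul_zero (C := C + C) fun t => ?_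
  exact (norm_sub_le _ _).trans (add_le_add (by simpa using hC' 1) (hC' _))

/-- The mean ergodic theorem for a power bounded operator `T` with `V = ker (1 - T) + ran (1 - T)`. -/
theorem exists_ergodic_projection [CompleteSpace V] {T : V →L[ℂ] V}
    (hb : ∀ x, x ∈ boundedOrbits (T : V →ₗ[ℂ] V))
    (hdec : ∀ v, ∃ k w, T k = k ∧ v = k + (w - T w)) :
    ∃ P : V →L[ℂ] V, IsIdempotentElem P ∧ (∀ x, x ∈ P.range ↔ T x = x) ∧
      ∀ v, Tendsto (cesaroAverage T v) atTop (𝓝 (P v)) := by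
  choose k w hk hv using hdec
  have hlim : ∀ v, Tendsto (cesaroAverage T v) atTop (𝓝 (k v)) := by
    intro v
    have := (cesaroAverage_tendsto_of_fixed (hk v)).add (cesaroAverage_tendsto_of_sub (hb (w v)))
    simp only [← cesaroAverage_add, ← hv, add_zero] at this
    exact this
  let A : ℕ → V →L[ℂ] V := fun t => (t : ℂ)⁻¹ • ∑ m ∈ Finset.Icc 1 t, T ^ m
  have hA : Tendsto (fun t x => A t x) atTop (𝓝 k) := by
    rw [tendsto_pi_nhds]
    intro v
    refine (hlim v).congr fun t => ?_
    simp [A, cesaroAverage]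
  have hfix : ∀ x, T x = x → k x = x := fun x hx =>
    tendsto_nhds_unique (hlim x) (cesaroAverage_tendsto_of_fixed hx)
  -- The chosen map k is a pointwise limit of bounded operators, hence linear, and bounded by
  -- Banach–Steinhaus.
  refine ⟨continuousLinearMapOfTendsto A hA, ?_, ?_, hlim⟩
  · ext v
    exact hfix _ (hk v)
  · intro x
    constructor
    · rintro ⟨y, rfl⟩
      exact hk y
    · intro hx
      exact ⟨x, hfix x hx⟩

/-- A common nonzero vector of ker (1 - B) and ran (1 - B) would give a Jordan block of size 2 at
eigenvalue 1, hence linear growth; rank-nullity then makes the two subspaces span. -/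
theorem exists_fixed_add_sub_of_finiteDimensional [FiniteDimensional ℂ V] {B : Module.End ℂ V}
    (hB : ∀ x, x ∈ boundedOrbits B) (v : V) : ∃ k w, B k = k ∧ v = k + (w - B w) := by
  have hdisj : Disjoint (1 - B).ker (1 - B).range := by
    rw [Submodule.disjoint_def]
    rintro y hy ⟨x, hx⟩
    have hy' : B y = (1 : ℂ) • y := by
      rw [LinearMap.mem_ker, LinearMap.sub_apply, Module.End.one_apply, sub_eq_zero] at hy
      rw [one_smul, ← hy]
    have hx' : B x = (1 : ℂ) • x + -y := by
      rw [← hx, LinearMap.sub_apply, Module.End.one_apply, one_smul]; abel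
    have := eq_zero_of_jordan hx' (by rw [map_neg, hy', smul_neg]) (by simp)
      (boundedOrbits_le_sublinearOrbits B (hB x))
    simpa using this
  have htop := Submodule.eq_top_of_disjoint _ _
    (by rw [add_comm, LinearMap.finrank_range_add_finrank_ker]) hdisj
  obtain ⟨k, hk, _, ⟨w, rfl⟩, h⟩ := Submodule.mem_sup.1 (htop ▸ Submodule.mem_top : v ∈ _)
  refine ⟨k, w, ?_, ?_⟩
  · rw [LinearMap.mem_ker, LinearMap.sub_apply, Module.End.one_apply, sub_eq_zero] at hk
    exact hk.symm
  · rw [← h]; simp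

end MeanErgodic

/-! ### Orbits of Riesz operators with a cyclic vector -/

section RieszOrbits

variable {V : Type*} [NormedAddCommGroup V] [NormedSpace ℂ V]

theorem mem_boundedOrbits_of_tendsto_zero {T : V →L[ℂ] V} {x : V}
    (h : Tendsto (fun t : ℕ => (T ^ t) x) atTop (𝓝 0)) : x ∈ boundedOrbits (T : V →ₗ[ℂ] V) := by
  obtain ⟨C, hC⟩ := h.norm.bddAbove_range
  refine ⟨C, fun t => ?_⟩
  rw [← ContinuousLinearMap.toLinearMap_pow]
  exact hC ⟨t, rfl⟩

theorem Commute.apply_pow {T Q : V →L[ℂ] V} (h : Commute Q T) (t : ℕ) (x : V) :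
    Q ((T ^ t) x) = (T ^ t) (Q x) :=
  congrArg (fun f : V →L[ℂ] V => f x) (h.pow_right t).eq

/-- This passes growth properties from s to every vector. The subspaces G of interest (bounded or
sublinear orbits) need not be closed, but the intersection with ran Q is finite-dimensional, hence
closed, and its preimage under Q contains the orbit of s. -/
theorem apply_mem_of_cyclic {T Q : V →L[ℂ] V} [FiniteDimensional ℂ Q.range] (hQT : Commute Q T)
    {s : V} (hs : ∀ C : Submodule ℂ V, IsClosed (C : Set V) → (∀ t : ℕ, (T ^ t) s ∈ C) → C = ⊤)
    {G : Submodule ℂ V} (hG : ∀ x ∈ G, T x ∈ G) (hsG : Q s ∈ G) (v : V) : Q v ∈ G := by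
  have hfd : FiniteDimensional ℂ (G ⊓ Q.range : Submodule ℂ V) :=
    Submodule.finiteDimensional_of_le inf_le_right
  have hcl : IsClosed ((G ⊓ Q.range : Submodule ℂ V) : Set V) :=
    Submodule.closed_of_finiteDimensional _
  have htop := hs ((G ⊓ Q.range).comap (Q : V →ₗ[ℂ] V)) (hcl.preimage Q.continuous) fun t => by
    refine ⟨?_, ⟨_, rfl⟩⟩
    show Q ((T ^ t) s) ∈ G
    rw [hQT.apply_pow]
    induction t with
    | zero => exact hsG
    | succ t ih => rw [pow_succ']; exact hG _ ih
  have : v ∈ (G ⊓ Q.range).comap (Q : V →ₗ[ℂ] V) := htop ▸ Submodule.mem_top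
  exact this.1

theorem tendsto_pow_sub_pow {T Q : V →L[ℂ] V} (hQ : IsIdempotentElem Q)
    (h0 : ∀ v, Q v = 0 → Tendsto (fun t : ℕ => (T ^ t) v) atTop (𝓝 0)) (v : V) :
    Tendsto (fun t : ℕ => (T ^ t) (v - Q v)) atTop (𝓝 0) := by
  refine h0 _ ?_
  rw [map_sub, sub_eq_zero]
  exact (congrArg (fun f : V →L[ℂ] V => f v) hQ.eq).symm

theorem restrict_pow_coe {B : V →ₗ[ℂ] V} {F : Submodule ℂ V} (hF : ∀ x ∈ F, B x ∈ F) (t : ℕ)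
    (x : F) : (((B.restrict hF) ^ t) x : V) = (B ^ t) x := by
  rw [Module.End.pow_restrict t]
  rfl

variable [CompleteSpace V] {T : V →L[ℂ] V} {s : V}

theorem IsRieszOperator.exists_finiteDimensional_orbit (hT : IsRieszOperator T) (s : V) :
    ∃ f : V, FiniteDimensional ℂ (Submodule.span ℂ (Set.range fun t : ℕ => (T ^ t) f)) ∧
      Tendsto (fun t : ℕ => (T ^ t) s - (T ^ t) f) atTop (𝓝 0) := by
  obtain ⟨Q, hQ, hQfin, hQT, h0, -⟩ := hT.exists_decomposition
  refine ⟨Q s, Submodule.finiteDimensional_of_le (S₂ := Q.range) ?_, ?_⟩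
  · rw [Submodule.span_le]
    rintro _ ⟨t, rfl⟩
    exact ⟨(T ^ t) s, hQT.apply_pow t s⟩
  · simpa only [map_sub] using tendsto_pow_sub_pow hQ h0 s

theorem IsRieszOperator.mem_boundedOrbits_of_cyclic (hT : IsRieszOperator T)
    (hs : ∀ C : Submodule ℂ V, IsClosed (C : Set V) → (∀ t : ℕ, (T ^ t) s ∈ C) → C = ⊤)
    (hb : s ∈ boundedOrbits (T : V →ₗ[ℂ] V))
    (v : V) : v ∈ boundedOrbits (T : V →ₗ[ℂ] V) := by
  obtain ⟨Q, hQ, hQfin, hQT, h0, -⟩ := hT.exists_decomposition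
  have hsub := fun v => mem_boundedOrbits_of_tendsto_zero (tendsto_pow_sub_pow hQ h0 v)
  have hQs : Q s ∈ boundedOrbits (T : V →ₗ[ℂ] V) := by
    simpa using Submodule.sub_mem _ hb (hsub s)
  simpa using Submodule.add_mem _ (hsub v)
    (apply_mem_of_cyclic hQT hs (fun _ => map_mem_boundedOrbits) hQs v)

theorem IsRieszOperator.mem_boundedOrbits_of_sublinear (hT : IsRieszOperator T)
    (hs : ∀ C : Submodule ℂ V, IsClosed (C : Set V) → (∀ t : ℕ, (T ^ t) s ∈ C) → C = ⊤)
    (hb : s ∈ sublinearOrbits (T : V →ₗ[ℂ] V)) : s ∈ boundedOrbits (T : V →ₗ[ℂ] V) := by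
  obtain ⟨Q, hQ, hQfin, hQT, h0, -⟩ := hT.exists_decomposition
  have hsub := mem_boundedOrbits_of_tendsto_zero (tendsto_pow_sub_pow hQ h0 s)
  have hQs : Q s ∈ sublinearOrbits (T : V →ₗ[ℂ] V) := by
    simpa using Submodule.sub_mem _ hb (boundedOrbits_le_sublinearOrbits _ hsub)
  have hall := apply_mem_of_cyclic hQT hs (fun _ => map_mem_sublinearOrbits) hQs
  have hF : ∀ x ∈ Q.range, (T : V →ₗ[ℂ] V) x ∈ Q.range := by
    rintro _ ⟨x, rfl⟩
    exact ⟨T x, by simpa using hQT.apply_pow 1 x⟩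
  -- By cyclicity all orbits in ran Q are sublinear, as the finite-dimensional criterion requires.
  have hB : ∀ x, x ∈ sublinearOrbits ((T : V →ₗ[ℂ] V).restrict hF) := by
    rintro ⟨_, v, rfl⟩
    rw [mem_sublinearOrbits, tendsto_subtype_rng]
    have := mem_sublinearOrbits.1 (hall v)
    simp only [Submodule.coe_smul, restrict_pow_coe]
    exact this
  obtain ⟨C, hC⟩ := mem_boundedOrbits_of_finiteDimensional hB ⟨Q s, s, rfl⟩
  have hQb : Q s ∈ boundedOrbits (T : V →ₗ[ℂ] V) := ⟨C, fun t => by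
    have := hC t
    rwa [Submodule.coe_norm, restrict_pow_coe] at this⟩
  simpa using Submodule.add_mem _ hsub hQb

/-- The component Q v is decomposed by linear algebra in ran Q; the component v - Q v lies in ker Q,
hence in ran (1 - T). -/
theorem IsRieszOperator.exists_fixed_add_sub (hT : IsRieszOperator T)
    (hb : ∀ x, x ∈ boundedOrbits (T : V →ₗ[ℂ] V)) (v : V) :
    ∃ k w, T k = k ∧ v = k + (w - T w) := by
  obtain ⟨Q, hQ, hQfin, hQT, -, h1⟩ := hT.exists_decomposition
  have hF : ∀ x ∈ Q.range, (T : V →ₗ[ℂ] V) x ∈ Q.range := by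
    rintro _ ⟨x, rfl⟩
    exact ⟨T x, by simpa using hQT.apply_pow 1 x⟩
  have hB : ∀ x, x ∈ boundedOrbits ((T : V →ₗ[ℂ] V).restrict hF) := fun x => by
    obtain ⟨C, hC⟩ := hb x
    exact ⟨C, fun t => by rw [Submodule.coe_norm, restrict_pow_coe]; exact hC t⟩
  obtain ⟨k, w, hk, hv⟩ := exists_fixed_add_sub_of_finiteDimensional hB ⟨Q v, v, rfl⟩
  obtain ⟨w', hw'⟩ := h1 (v - Q v) (by
    rw [map_sub, sub_eq_zero]
    exact (congrArg (fun f : V →L[ℂ] V => f v) hQ.eq).symm)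
  have hk' : T k = k := congrArg Subtype.val hk
  have hv' : Q v = k + (w - T w) := congrArg Subtype.val hv
  refine ⟨k, w + w', hk', ?_⟩
  have h2 : v = Q v + (v - Q v) := by abel
  rw [h2, ← hw', hv', map_add]
  abel

end RieszOrbits

/-! ### Translation between evolutions and bounded operators -/

namespace Evolution

variable {U : Type*} [NormedAddCommGroup U] [NormedSpace ℂ U] {Ψ : Evolution U}

theorem coe_pow_closedInit {T : Ψ.closedSpace →L[ℂ] Ψ.closedSpace} (hT : Ψ.IsExtension T) (t : ℕ) :
    ((T ^ t) Ψ.closedInit : U) = Ψ.state t := by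
  induction t with
  | zero => rfl
  | succ t ih =>
    rw [pow_succ']
    show (T ((T ^ t) Ψ.closedInit) : U) = _
    rw [hT _ (by rw [ih]; exact Ψ.state_mem_space t), ih, state, state, pow_succ']
    rfl

/-- The states span a dense subspace of the closed evolution space, so the initial state is a cyclic
vector. -/
theorem eq_top_of_states_mem {C : Submodule ℂ Ψ.closedSpace} (hC : IsClosed (C : Set Ψ.closedSpace))
    (h : ∀ t, (⟨Ψ.state t, Ψ.space.le_topologicalClosure (Ψ.state_mem_space t)⟩ : Ψ.closedSpace) ∈ C) :
    C = ⊤ := by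
  have hle : Ψ.space ≤ C.map Ψ.closedSpace.subtype := by
    rw [space, Submodule.span_le]
    rintro _ ⟨t, rfl⟩
    exact ⟨_, h t, rfl⟩
  rw [Submodule.eq_top_iff']
  intro x
  have hx : (x : U) ∈ closure (Ψ.space : Set U) := x.2
  rw [mem_closure_iff_seq_limit] at hx
  obtain ⟨u, hu, hlim⟩ := hx
  have hmem : ∀ n, ∃ y ∈ C, (y : U) = u n := fun n => hle (hu n)
  choose y hy hyu using hmem
  refine hC.mem_of_tendsto (f := y) (b := atTop) ?_ (Eventually.of_forall hy)
  rw [tendsto_subtype_rng]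
  simpa only [hyu] using hlim

theorem eq_top_of_pow_closedInit_mem {T : Ψ.closedSpace →L[ℂ] Ψ.closedSpace} (hT : Ψ.IsExtension T)
    (C : Submodule ℂ Ψ.closedSpace) (hC : IsClosed (C : Set Ψ.closedSpace))
    (h : ∀ t : ℕ, (T ^ t) Ψ.closedInit ∈ C) : C = ⊤ :=
  eq_top_of_states_mem hC fun t => by
    convert h t
    exact (coe_pow_closedInit hT t).symm

theorem IsExtension.unique {S T : Ψ.closedSpace →L[ℂ] Ψ.closedSpace} (hS : Ψ.IsExtension S)
    (hT : Ψ.IsExtension T) : S = T := by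
  have := eq_top_of_states_mem (C := (S - T).ker) (S - T).isClosed_ker fun t => by
    rw [LinearMap.mem_ker]
    show S _ - T _ = 0
    rw [sub_eq_zero]
    refine Subtype.ext ?_
    rw [hS _ (Ψ.state_mem_space t), hT _ (Ψ.state_mem_space t)]
  ext1 x
  have hx : x ∈ (S - T).ker := this ▸ Submodule.mem_top
  exact sub_eq_zero.1 hx

theorem stable_iff : Ψ.Stable ↔ ∃ C : ℝ, ∀ t, ‖Ψ.state t‖ ≤ C := by
  have h1 : Ψ.Stable ↔ ∃ c : ℝ, ∀ t, ‖Ψ.state t‖ ≤ c * ‖Ψ.init‖ := by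
    rw [Stable, evolutionNorm, sInf_lt_iff]
    constructor
    · rintro ⟨_, ⟨c, -, hc⟩, -⟩
      exact ⟨c, hc⟩
    · rintro ⟨c, hc⟩
      exact ⟨c, ⟨c, rfl, hc⟩, EReal.coe_lt_top c⟩
  rw [h1]
  constructor
  · rintro ⟨c, hc⟩
    exact ⟨_, hc⟩
  · rintro ⟨C, hC⟩
    -- If s = 0, all states vanish; otherwise the bound can be divided by ‖s‖.
    by_cases h0 : Ψ.init = 0
    · exact ⟨0, fun t => by simp [state, h0]⟩
    · exact ⟨C / ‖Ψ.init‖, fun t => by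
        rw [div_mul_cancel₀ _ (norm_ne_zero_iff.2 h0)]; exact hC t⟩

theorem stable_iff_mem_boundedOrbits {T : Ψ.closedSpace →L[ℂ] Ψ.closedSpace}
    (hT : Ψ.IsExtension T) :
    Ψ.Stable ↔ Ψ.closedInit ∈ boundedOrbits (T : Ψ.closedSpace →ₗ[ℂ] Ψ.closedSpace) := by
  rw [stable_iff, mem_boundedOrbits]
  simp only [← ContinuousLinearMap.toLinearMap_pow, ContinuousLinearMap.coe_coe, Submodule.coe_norm,
    coe_pow_closedInit hT]

theorem coe_cesaroAverage_closedInit {T : Ψ.closedSpace →L[ℂ] Ψ.closedSpace}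
    (hT : Ψ.IsExtension T) (t : ℕ) :
    ((cesaroAverage T Ψ.closedInit t : Ψ.closedSpace) : U) = Ψ.stateAverage t := by
  simp only [cesaroAverage, stateAverage, Submodule.coe_smul, Submodule.coe_sum,
    coe_pow_closedInit hT]

/-- With a(t) the averages, the state at t + 1 divided by t + 1 equals a(t + 1) - t/(t + 1) a(t),
and both terms have the same limit. -/
theorem MeanErgodic.tendsto_inv_smul_state (h : Ψ.MeanErgodic) :
    Tendsto (fun t : ℕ => (t : ℂ)⁻¹ • Ψ.state t) atTop (𝓝 0) := by
  obtain ⟨l, -, hl⟩ := h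
  rw [← tendsto_add_atTop_iff_nat 1]
  have hq : Tendsto (fun t : ℕ => ((t + 1 : ℕ) : ℂ)⁻¹ * (t : ℂ)) atTop (𝓝 1) := by
    simpa using tendsto_succ_div_atTop.inv₀ one_ne_zero
  have h1 := (hl.comp (tendsto_add_atTop_nat 1)).sub (hq.smul hl)
  rw [one_smul, sub_self] at h1
  refine h1.congr' ?_
  filter_upwards [eventually_ge_atTop 1] with t ht
  have ht0 : (t : ℂ) ≠ 0 := by exact_mod_cast (by omega : t ≠ 0)
  simp only [Function.comp_apply, stateAverage]
  rw [Finset.sum_Icc_succ_top (by omega), smul_smul, mul_assoc, mul_inv_cancel₀ ht0, mul_one,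
    smul_add, add_sub_cancel_left]

theorem finitary_of_isRieszOperator [CompleteSpace U] {T : Ψ.closedSpace →L[ℂ] Ψ.closedSpace}
    (hT : Ψ.IsExtension T) (hR : IsRieszOperator T) : Ψ.Finitary := by
  obtain ⟨f, hfin, hlim⟩ := hR.exists_finiteDimensional_orbit Ψ.closedInit
  -- An algebraic extension of T to all of U suffices, as the operator of an evolution need not be
  -- bounded.
  obtain ⟨φ, hφ⟩ := LinearMap.exists_extend
    (Ψ.closedSpace.subtype ∘ₗ (T : Ψ.closedSpace →ₗ[ℂ] Ψ.closedSpace))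
  have hφ' : ∀ x : Ψ.closedSpace, φ x = T x := fun x => LinearMap.congr_fun hφ x
  have hst : ∀ t, (⟨φ, f⟩ : Evolution U).state t = (T ^ t) f := by
    intro t
    induction t with
    | zero => rfl
    | succ t ih =>
      have : (⟨φ, f⟩ : Evolution U).state (t + 1) = φ ((⟨φ, f⟩ : Evolution U).state t) := by
        rw [state, state, pow_succ']; rfl
      rw [this, ih, hφ', pow_succ']
      rfl
  refine ⟨⟨φ, f⟩, ?_, ?_⟩
  · have : (⟨φ, f⟩ : Evolution U).space =
        (Submodule.span ℂ (Set.range fun t : ℕ => (T ^ t) f)).map Ψ.closedSpace.subtype := by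
      rw [space, Submodule.map_span, ← Set.range_comp]
      congr 2
      funext t
      exact hst t
    rw [IsFiniteDimensional, this]
    infer_instance
  · rw [Equivalent]
    have := (Ψ.closedSpace.subtypeL.continuous.tendsto 0).comp hlim
    rw [map_zero] at this
    have := this.norm
    rw [norm_zero] at this
    refine this.congr fun t => ?_
    rw [hst, norm_sub_rev, ← coe_pow_closedInit hT]
    simp [norm_sub_rev]

end Evolution

/-! ### The theorem on Riesz evolutions -/

theorem mainTheorem2 {U : Type*} [NormedAddCommGroup U] [NormedSpace ℂ U] [CompleteSpace U]
    (Ψ : Evolution U) (hΨ : Ψ.IsRiesz) :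
    Ψ.Finitary ∧
    (Ψ.MeanErgodic ↔ Ψ.Stable) ∧
    (Ψ.Stable → ∀ T : Ψ.closedSpace →L[ℂ] Ψ.closedSpace, Ψ.IsExtension T →
      (¬ Module.End.HasEigenvalue (T : Ψ.closedSpace →ₗ[ℂ] Ψ.closedSpace) 1 →
        Tendsto Ψ.stateAverage atTop (𝓝 0) ∧
        ∀ v : Ψ.closedSpace, Tendsto (cesaroAverage T v) atTop (𝓝 0)) ∧
      (Module.End.HasEigenvalue (T : Ψ.closedSpace →ₗ[ℂ] Ψ.closedSpace) 1 →
        ∃ P₁ : Ψ.closedSpace →L[ℂ] Ψ.closedSpace,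
          IsIdempotentElem P₁ ∧
          (∀ x : Ψ.closedSpace, x ∈ P₁.range ↔ T x = x) ∧
          Tendsto Ψ.stateAverage atTop (𝓝 (P₁ Ψ.closedInit : U)) ∧
          ∀ v : Ψ.closedSpace, Tendsto (cesaroAverage T v) atTop (𝓝 (P₁ v)))) := by
  obtain ⟨T, hT, hR⟩ := hΨ
  have hcyc := Evolution.eq_top_of_pow_closedInit_mem hT
  have hstable : Ψ.Stable → ∃ P : Ψ.closedSpace →L[ℂ] Ψ.closedSpace, IsIdempotentElem P ∧
      (∀ x, x ∈ P.range ↔ T x = x) ∧ Tendsto Ψ.stateAverage atTop (𝓝 (P Ψ.closedInit : U)) ∧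
      ∀ v, Tendsto (cesaroAverage T v) atTop (𝓝 (P v)) := by
    intro hst
    have hb := hR.mem_boundedOrbits_of_cyclic hcyc
      ((Evolution.stable_iff_mem_boundedOrbits hT).1 hst)
    obtain ⟨P, hP, hPr, hlim⟩ := exists_ergodic_projection hb (hR.exists_fixed_add_sub hb)
    refine ⟨P, hP, hPr, ?_, hlim⟩
    have := tendsto_subtype_rng.1 (hlim Ψ.closedInit)
    exact this.congr (Evolution.coe_cesaroAverage_closedInit hT)
  refine ⟨Evolution.finitary_of_isRieszOperator hT hR, ⟨fun hme => ?_, fun hst => ?_⟩,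
    fun hst S hS => ?_⟩
  · rw [Evolution.stable_iff_mem_boundedOrbits hT]
    refine hR.mem_boundedOrbits_of_sublinear hcyc ?_
    rw [mem_sublinearOrbits, tendsto_subtype_rng]
    refine hme.tendsto_inv_smul_state.congr fun t => ?_
    rw [← Evolution.coe_pow_closedInit hT, ← ContinuousLinearMap.toLinearMap_pow]
    rfl
  · obtain ⟨P, -, -, hlim, -⟩ := hstable hst
    exact ⟨_, (P Ψ.closedInit).2, hlim⟩
  · obtain rfl := hS.unique hT
    obtain ⟨P, hP, hPr, hlim, hlim'⟩ := hstable hst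
    refine ⟨fun h1 => ?_, fun _ => ⟨P, hP, hPr, hlim, hlim'⟩⟩
    -- Every P v is a fixed vector of the operator, so a nonzero one would be an eigenvector for 1.
    have hP0 : ∀ v, P v = 0 := by
      intro v
      by_contra h0
      refine h1 (Module.End.hasEigenvalue_of_hasEigenvector (x := P v) ⟨?_, h0⟩)
      rw [Module.End.mem_eigenspace_iff, one_smul]
      exact (hPr _).1 ⟨v, rfl⟩
    simp only [hP0, Submodule.coe_zero] at hlim hlim'
    exact ⟨hlim, hlim'⟩
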